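/- Let $f:\mathbb C^2\to\mathbb C^2$ be a polynomial diffeomorphism whose dynamical degree $d(f)=\lim_{n\to\infty}(\deg f^n)^{1/n}$ is greater than $1$ (here $\deg$ is the maximum of the degrees of the coordinate polynomials). Let $K^{\pm}$ be the set of points whose orbit under $f^{\pm1}$ is bounded, and let $J=\partial K^+\cap\partial K^-$ be the Julia set. On $\mathbb C^2=\mathbb R^4$ use the norm $\|x\|_\infty=\max_{i}\max(|\operatorname{Re}x_i|,|\operatorname{Im}x_i|)$; a closed box is a closed ball of positive radius in this norm, and $\mathcal N(B,\delta)$ is the $\delta$-neighborhood of $B$ in this norm. A box chain model $\Gamma$ of $f$ on $J$ is a strongly connected directed graph whose vertices are finitely many closed boxes $B_1,\dots,B_N$ with pairwise disjoint interiors and $J\subset\bigcup_k B_k$, such that for some $\delta>0$ there is an edge $(k,j)$ whenever $f(B_k)\cap\mathcal N(B_j,\delta)\neq\emptyset$ (further edges are allowed). It is box hyperbolic if there are nondegenerate indefinite Hermitian forms $Q_k:\mathbb C^2\to\mathbb R$, $1\le k\le N$, such that, with $C^u_k=\{w: Q_k(w)\ge 0\}$ and $C^s_k=\mathbb C^2\setminus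 C^u_k$, for every edge $(k,j)$ and every $z\in B_k$: 1. if $w\in C^u_k$ and $w\ne0$, then $D_zf(w)\in C^u_j$ and $Q_j(D_zf(w))>Q_k(w)$; 2. if $v\in C^s_j$, then $[D_zf]^{-1}(v)\in C^s_k$ and $-Q_k([D_zf]^{-1}(v))>-Q_j(v)$. Theorem. If $\Gamma$ is a box chain model of $f$ on $J$ and $\Gamma$ is box hyperbolic, then $f$ is hyperbolic on $J$; that is, $J$ is compact, $f(J)=J$, and there are a splitting $T_x\mathbb C^2=E^s_x\oplus E^u_x$ into complex subspaces, varying continuously with $x\in J$, a norm $\|\cdot\|_x$ on $T_x\mathbb C^2$, continuous for $x\in J$, and a constant $\lambda>1$ such that for all $x\in J$: $D_xf(E^s_x)=E^s_{f(x)}$ and $D_xf(E^u_x)=E^u_{f(x)}$; $\|D_xf(w)\|_{f(x)}\ge\lambda\|w\|_x$ for $w\in E^u_x$; and $\|D_xf^{-1}(w)\|_{f^{-1}(x)}\ge\lambda\|w\|_x$ for $w\in E^s_x$. -/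

import Mathlib

open scoped ContDiff Topology Matrix

noncomputable section

namespace BoxHyp

/-- The complex plane `ℂ²`; it is also identified with each of its tangent spaces. -/
abbrev C2 : Type := Fin 2 → ℂ

/-! ### Polynomial diffeomorphisms and the dynamical degree -/

/-- The coordinate polynomials `p` represent the map `F`. -/
def Represents (p : Fin 2 → MvPolynomial (Fin 2) ℂ) (F : C2 → C2) : Prop :=
  ∀ x i, F x i = MvPolynomial.eval x (p i)

/-- A bijection of `ℂ²` given by polynomials whose inverse is smooth (the map itself, being
polynomial, is smooth as well). -/
def IsPolynomialDiffeo (f : C2 ≃ C2) : Prop :=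
  (∃ p, Represents p f) ∧ ContDiff ℝ ∞ f.symm

/-- The degree of a polynomial map: the maximum of the total degrees of its coordinate
polynomials (which are uniquely determined by the map). -/
def polyDegree (F : C2 → C2) : ℕ :=
  sInf {m | ∃ p, Represents p F ∧ ∀ i, (p i).totalDegree ≤ m}

/-- `d` is the dynamical degree `lim (deg fⁿ)^(1/n)` of `f`. -/
def HasDynamicalDegree (f : C2 → C2) (d : ℝ) : Prop :=
  Filter.Tendsto (fun n : ℕ => (polyDegree f^[n] : ℝ) ^ (1 / (n : ℝ))) Filter.atTop (𝓝 d)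

/-! ### Julia sets -/

/-- `K⁺`: the points with bounded forward orbit. -/
def Kplus (f : C2 ≃ C2) : Set C2 :=
  {x | Bornology.IsBounded (Set.range fun n : ℕ => f^[n] x)}

/-- `K⁻`: the points with bounded backward orbit. -/
def Kminus (f : C2 ≃ C2) : Set C2 := Kplus f.symm

/-- The Julia set `J = ∂K⁺ ∩ ∂K⁻`. -/
def juliaSet (f : C2 ≃ C2) : Set C2 := frontier (Kplus f) ∩ frontier (Kminus f)

/-! ### Hyperbolic sets -/

/-- `Λ` is a hyperbolic set of the diffeomorphism `f`: it is compact and invariant, and over it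
there are a continuous invariant splitting `Es ⊕ Eu` of the tangent bundle and a continuous norm
`‖·‖_x` for which `Df` uniformly expands `Eu` and `Df⁻¹` uniformly expands `Es`.
Continuity of the splitting is continuity in `x` of the projection `P x` onto `Eu x` with
kernel `Es x`. Values of `Es`, `Eu`, `P`, `nrm` off `Λ` play no role. -/
def IsHyperbolicOn (f : C2 ≃ C2) (Λ : Set C2) : Prop :=
  IsCompact Λ ∧ f '' Λ = Λ ∧
  ∃ (Es Eu : C2 → Submodule ℂ C2) (P : C2 → C2 →L[ℂ] C2) (nrm : C2 → Seminorm ℂ C2) (lam : ℝ),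
    (∀ x ∈ Λ, IsCompl (Es x) (Eu x)) ∧
    (∀ x ∈ Λ, (∀ v ∈ Eu x, P x v = v) ∧ ∀ v ∈ Es x, P x v = 0) ∧
    ContinuousOn P Λ ∧
    (∀ x ∈ Λ, (Es x).map (fderiv ℂ f x : C2 →ₗ[ℂ] C2) = Es (f x)) ∧
    (∀ x ∈ Λ, (Eu x).map (fderiv ℂ f x : C2 →ₗ[ℂ] C2) = Eu (f x)) ∧
    (∀ x ∈ Λ, ∀ v, nrm x v = 0 → v = 0) ∧
    ContinuousOn (fun q : C2 × C2 => nrm q.1 q.2) (Λ ×ˢ Set.univ) ∧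
    1 < lam ∧
    (∀ x ∈ Λ, ∀ w ∈ Eu x, lam * nrm x w ≤ nrm (f x) (fderiv ℂ f x w)) ∧
    (∀ x ∈ Λ, ∀ w ∈ Es x, lam * nrm x w ≤ nrm (f.symm x) (fderiv ℂ f.symm x w))

/-! ### Boxes and box chain models -/

/-- The `L^∞` norm of `ℝ⁴ = ℂ²`. -/
def boxNorm (x : C2) : ℝ :=
  max (max |(x 0).re| |(x 0).im|) (max |(x 1).re| |(x 1).im|)

/-- The closed box with centre `c` and radius `r`. -/
def box (c : C2) (r : ℝ) : Set C2 := {x | boxNorm (x - c) ≤ r}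

/-- The `δ`-neighbourhood of a set in the `L^∞` metric. -/
def nbhd (B : Set C2) (δ : ℝ) : Set C2 := {x | ∃ y ∈ B, boxNorm (x - y) < δ}

/-- A box chain model of `f` on `J`: a strongly connected directed graph on finitely many closed
boxes with disjoint interiors that cover `J`, having (at least) all edges `k ⟶ j` for which
`f (B k)` meets the `δ`-neighbourhood of `B j`, for some `δ > 0`. -/
structure BoxChainModel (f : C2 ≃ C2) (J : Set C2) where
  /-- the number of boxes -/
  N : ℕ
  /-- the centres of the boxes -/
  center : Fin N → C2
  /-- the radii of the boxes -/
  radius : Fin N → ℝ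
  radius_pos : ∀ k, 0 < radius k
  disjoint_interiors : ∀ k j, k ≠ j →
    Disjoint (interior (box (center k) (radius k))) (interior (box (center j) (radius j)))
  covers : J ⊆ ⋃ k, box (center k) (radius k)
  /-- the directed graph on the (indices of the) boxes -/
  graph : Digraph (Fin N)
  has_edges : ∃ δ > 0, ∀ k j,
    (f '' box (center k) (radius k) ∩ nbhd (box (center j) (radius j)) δ).Nonempty →
      graph.Adj k j
  strongly_connected : ∀ k j, Relation.ReflTransGen graph.Adj k j

/-- The `k`-th box of the model. -/
def BoxChainModel.B {f : C2 ≃ C2} {J : Set C2} (Γ : BoxChainModel f J) (k : Fin Γ.N) : Set C2 :=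
  box (Γ.center k) (Γ.radius k)

/-! ### Box hyperbolicity -/

/-- The form `w ↦ w* A w`, which is real valued for Hermitian `A`. -/
def form (A : Matrix (Fin 2) (Fin 2) ℂ) (w : C2) : ℝ := (star w ⬝ᵥ A *ᵥ w).re

/-- `A` defines a nondegenerate indefinite Hermitian form. -/
def IsIndefiniteHermitian (A : Matrix (Fin 2) (Fin 2) ℂ) : Prop :=
  A.IsHermitian ∧ A.det ≠ 0 ∧ (∃ w, 0 < form A w) ∧ ∃ v, form A v < 0

/-- The unstable cone of a form. -/
def unstableCone (A : Matrix (Fin 2) (Fin 2) ℂ) : Set C2 := {w | 0 ≤ form A w}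

/-- The stable cone of a form, the complement of the unstable cone. -/
def stableCone (A : Matrix (Fin 2) (Fin 2) ℂ) : Set C2 := (unstableCone A)ᶜ

/-- Box hyperbolicity: for some choice of nondegenerate indefinite Hermitian forms `Q k`, one for
each box, `Df` preserves and expands the unstable cones and `(Df)⁻¹` preserves and expands the
stable cones along all edges. (The zero vector lies in every unstable cone and cannot be
strictly expanded.) -/
def BoxChainModel.IsBoxHyperbolic {f : C2 ≃ C2} {J : Set C2} (Γ : BoxChainModel f J) : Prop :=
  ∃ Q : Fin Γ.N → Matrix (Fin 2) (Fin 2) ℂ,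
    (∀ k, IsIndefiniteHermitian (Q k)) ∧
    ∀ k j, Γ.graph.Adj k j → ∀ z ∈ Γ.B k,
      (∀ w ∈ unstableCone (Q k), w ≠ 0 →
        fderiv ℂ f z w ∈ unstableCone (Q j) ∧
        form (Q k) w < form (Q j) (fderiv ℂ f z w)) ∧
      (∀ v ∈ stableCone (Q j),
        (fderiv ℂ f z).inverse v ∈ stableCone (Q k) ∧
        -form (Q j) v < -form (Q k) ((fderiv ℂ f z).inverse v))

end BoxHyp

end

/-!
Over each point of `J` take the form `q x` of a box that contains it. The cone conditions say that
`q` strictly increases along `Df`, hence, by homogeneity and compactness of the boxes, by at least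
`c * ‖w‖ ^ 2`. A vector whose forward orbit is bounded therefore satisfies `q ≤ 0` along the whole
orbit, since a positive value would grow exponentially; conversely, `q ≤ 0` along the orbit forces
`|q|`, and with it the vector, to decay exponentially at a uniform rate. Nonzero vectors of this
kind exist over every point by a nested compactness argument. The same holds for `f.symm` and `-q`,
so in dimension two the vectors with bounded forward orbit and those with bounded backward orbit
form complementary lines. Uniformity of the decay makes both families of lines closed, which gives
continuity of the splitting, and a weighted sum of the norms of finitely many iterates turns
exponential decay into contraction in a single step.
-/

namespace BoxHyp

open Set Filter Function
open scoped NNReal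

section Homogeneous

variable {𝕜 E : Type*} [RCLike 𝕜] [NormedAddCommGroup E] [NormedSpace 𝕜 E]

lemma eq_norm_sq_mul_apply_normalize {g : E → ℝ}
    (hsmul : ∀ (t : 𝕜) w, g (t • w) = ‖t‖ ^ 2 * g w) (w : E) :
    g w = ‖w‖ ^ 2 * g ((‖w‖⁻¹ : 𝕜) • w) := by
  rcases eq_or_ne w 0 with rfl | hw
  · simpa using hsmul 0 0
  · have : ‖w‖ ≠ 0 := norm_ne_zero_iff.2 hw
    rw [hsmul, norm_inv, RCLike.norm_ofReal, abs_norm]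
    field_simp

lemma eventually_abs_le_mul_norm_sq [FiniteDimensional 𝕜 E] {g : E → ℝ} (hg : Continuous g)
    (hsmul : ∀ (t : 𝕜) w, g (t • w) = ‖t‖ ^ 2 * g w) :
    ∀ᶠ M in atTop, ∀ w, |g w| ≤ M * ‖w‖ ^ 2 := by
  have : ProperSpace E := FiniteDimensional.proper 𝕜 E
  obtain ⟨C, hC⟩ := (isCompact_closedBall (0 : E) 1).exists_bound_of_continuousOn hg.continuousOn
  filter_upwards [eventually_ge_atTop C] with M hM w
  have hball : (‖w‖⁻¹ : 𝕜) • w ∈ Metric.closedBall (0 : E) 1 := by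
    rw [mem_closedBall_zero_iff, norm_smul, norm_inv, RCLike.norm_ofReal, abs_norm]
    exact inv_mul_le_one
  rw [eq_norm_sq_mul_apply_normalize hsmul w, abs_mul, abs_sq, mul_comm]
  exact mul_le_mul_of_nonneg_right ((hC _ hball).trans hM) (sq_nonneg _)

lemma eventually_mul_norm_sq_le [FiniteDimensional 𝕜 E] {Y : Type*} [TopologicalSpace Y]
    {K : Set Y} (hK : IsCompact K) {g : Y → E → ℝ} (hg : Continuous (uncurry g))
    (hsmul : ∀ y (t : 𝕜) w, g y (t • w) = ‖t‖ ^ 2 * g y w)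
    (hpos : ∀ y ∈ K, ∀ w ≠ 0, 0 < g y w) :
    ∀ᶠ c in 𝓝[>] (0 : ℝ), ∀ y ∈ K, ∀ w, c * ‖w‖ ^ 2 ≤ g y w := by
  have : ProperSpace E := FiniteDimensional.proper 𝕜 E
  obtain ⟨c₀, hc₀, hle⟩ := (hK.prod (isCompact_sphere (0 : E) 1)).exists_forall_le'
    hg.continuousOn (a := 0) fun p hp => hpos p.1 hp.1 p.2 (ne_zero_of_mem_unit_sphere ⟨_, hp.2⟩)
  filter_upwards [Ioo_mem_nhdsGT hc₀] with c hc y hy w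
  rw [eq_norm_sq_mul_apply_normalize (hsmul y) w, mul_comm]
  rcases eq_or_ne w 0 with rfl | hw
  · simp
  · have hsphere : (‖w‖⁻¹ : 𝕜) • w ∈ Metric.sphere (0 : E) 1 :=
      mem_sphere_zero_iff_norm.2 (norm_smul_inv_norm hw)
    exact mul_le_mul_of_nonneg_left (hc.2.le.trans (hle (y, _) ⟨hy, hsphere⟩)) (sq_nonneg _)

end Homogeneous

section Splitting

variable {𝕜 E Y : Type*} [RCLike 𝕜] [NormedAddCommGroup E] [NormedSpace 𝕜 E]
  [FiniteDimensional 𝕜 E] [TopologicalSpace Y] {S U : Y → Submodule 𝕜 E}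

/-- By compactness of the unit sphere, the angle between the fibres is locally bounded below. -/
lemma exists_eventually_mul_norm_le (hS : IsClosed {p : Y × E | p.2 ∈ S p.1})
    (hU : IsClosed {p : Y × E | p.2 ∈ U p.1}) {y₀ : Y} (hdisj : Disjoint (U y₀) (S y₀)) :
    ∃ ε > 0, ∀ᶠ y in 𝓝 y₀, ∀ u ∈ U y, ∀ s ∈ S y, ε * ‖u‖ ≤ ‖u + s‖ := by
  have : ProperSpace E := FiniteDimensional.proper 𝕜 E
  have hopen : IsOpen {p : (Y × E) × E | ¬(p.2 ∈ U p.1.1 ∧ p.1.2 - p.2 ∈ S p.1.1)} :=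
    ((hU.preimage (by fun_prop : Continuous fun p : (Y × E) × E => (p.1.1, p.2))).inter
      (hS.preimage (by fun_prop : Continuous fun p : (Y × E) × E =>
        (p.1.1, p.1.2 - p.2)))).isOpen_compl
  have hsphere : ∀ᶠ p in 𝓝 (y₀, (0 : E)), ∀ u ∈ Metric.sphere (0 : E) 1,
      ¬(u ∈ U p.1 ∧ p.2 - u ∈ S p.1) := by
    refine (isCompact_sphere (0 : E) 1).eventually_forall_of_forall_eventually
      (x₀ := (y₀, (0 : E))) (P := fun (p : Y × E) u => ¬(u ∈ U p.1 ∧ p.2 - u ∈ S p.1))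
      fun u hu => hopen.mem_nhds (x := ((y₀, 0), u)) fun ⟨hu₁, hu₂⟩ => ?_
    rw [zero_sub, neg_mem_iff] at hu₂
    exact ne_zero_of_mem_unit_sphere ⟨u, hu⟩ (Submodule.disjoint_def.1 hdisj u hu₁ hu₂)
  rw [nhds_prod_eq] at hsphere
  obtain ⟨N, hN, V, hV, hNV⟩ := eventually_prod_iff.1 hsphere
  obtain ⟨ε, hε, hball⟩ := Metric.eventually_nhds_iff.1 hV
  refine ⟨ε, hε, hN.mono fun y hy u hu s hs => ?_⟩
  by_contra! hlt
  have hu0 : u ≠ 0 := by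
    rintro rfl
    simp [(norm_nonneg s).not_gt] at hlt
  have hsmall : dist ((‖u‖⁻¹ : 𝕜) • (u + s)) 0 < ε := by
    rwa [dist_zero_right, norm_smul, norm_inv, RCLike.norm_ofReal, abs_norm,
      inv_mul_lt_iff₀ (norm_pos_iff.2 hu0), mul_comm]
  refine hNV hy (hball hsmall) _ (mem_sphere_zero_iff_norm.2 (norm_smul_inv_norm (𝕜 := 𝕜) hu0))
    ⟨Submodule.smul_mem _ _ hu, ?_⟩
  rw [← smul_sub, add_sub_cancel_left]
  exact Submodule.smul_mem _ _ hs

lemma continuous_projection (hS : IsClosed {p : Y × E | p.2 ∈ S p.1})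
    (hU : IsClosed {p : Y × E | p.2 ∈ U p.1}) (h : ∀ y, IsCompl (U y) (S y)) :
    Continuous fun y => ((U y).projection (S y) (h y)).toContinuousLinearMap := by
  have : ProperSpace E := FiniteDimensional.proper 𝕜 E
  refine continuous_clm_apply.2 fun v => continuous_iff_continuousAt.2 fun y₀ => ?_
  have hU_mem (y : Y) : (U y).projection (S y) (h y) v ∈ U y :=
    Submodule.projection_apply_mem (h y) v
  have hS_mem (y : Y) : v - (U y).projection (S y) (h y) v ∈ S y := by
    rw [← Submodule.projection_eq_self_sub_projection]
    exact Submodule.projection_apply_mem (h y).symm v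
  obtain ⟨ε, hε, hangle⟩ := exists_eventually_mul_norm_le hS hU (h y₀).disjoint
  refine (isCompact_closedBall (0 : E) (‖v‖ / ε)).tendsto_nhds_of_unique_mapClusterPt ?_ ?_
  · filter_upwards [hangle] with y hy
    have := hy _ (hU_mem y) _ (hS_mem y)
    rw [add_sub_cancel] at this
    exact mem_closedBall_zero_iff.2 ((le_div_iff₀' hε).2 this)
  · intro u _ hu
    obtain ⟨l, hl, hlu⟩ := mapClusterPt_iff_ultrafilter.1 hu
    have hl' : Tendsto (fun y : Y => y) l (𝓝 y₀) := hl
    have hu₁ : u ∈ U y₀ := hU.mem_of_tendsto (hl'.prodMk_nhds hlu) (.of_forall hU_mem)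
    have hu₂ : v - u ∈ S y₀ := hS.mem_of_tendsto (hl'.prodMk_nhds (hlu.const_sub v))
      (.of_forall hS_mem)
    calc u = (U y₀).projection (S y₀) (h y₀) (u + (v - u)) := by
          rw [map_add, Submodule.projection_apply_of_mem_left _ hu₁,
            Submodule.projection_apply_of_mem_right _ hu₂, add_zero]
      _ = (U y₀).projection (S y₀) (h y₀) v := by rw [add_sub_cancel]

lemma exists_continuousOn_projection {X : Type*} [TopologicalSpace X] {J : Set X}
    {S U : X → Submodule 𝕜 E} (hS : IsClosed {p : J × E | p.2 ∈ S p.1})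
    (hU : IsClosed {p : J × E | p.2 ∈ U p.1}) (h : ∀ x ∈ J, IsCompl (S x) (U x)) :
    ∃ P : X → E →L[𝕜] E, ContinuousOn P J ∧
      ∀ x ∈ J, (∀ v ∈ U x, P x v = v) ∧ ∀ v ∈ S x, P x v = 0 := by
  classical
  let P (x : X) : E →L[𝕜] E := if hx : x ∈ J then
    ((U x).projection (S x) (h x hx).symm).toContinuousLinearMap else 0
  have hP {x : X} (hx : x ∈ J) (v : E) :
      P x v = (U x).projection (S x) (h x hx).symm v := by simp [P, hx]
  refine ⟨P, continuousOn_iff_continuous_domRestrict.2 ?_,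
    fun x hx => ⟨fun v hv => ?_, fun v hv => ?_⟩⟩
  · convert continuous_projection (S := fun y : J => S y) (U := fun y : J => U y) hS hU
      fun y => (h y y.2).symm using 2 with y
    exact dif_pos y.2
  · rw [hP hx, Submodule.projection_apply_of_mem_left _ hv]
  · rw [hP hx, Submodule.projection_apply_of_mem_right _ hv]

end Splitting

/-- An invertible continuous linear cocycle: the homeomorphism `base` of `X` lifts to the
automorphism `(x, w) ↦ (base x, fiber x w)` of the trivial bundle `X × E`. -/
@[ext]
structure LinearCocycle (𝕜 X E : Type*) [NontriviallyNormedField 𝕜] [TopologicalSpace X]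
    [NormedAddCommGroup E] [NormedSpace 𝕜 E] where
  base : X ≃ₜ X
  fiber : X → E ≃L[𝕜] E
  continuous_fiber : Continuous fun x => (fiber x : E →L[𝕜] E)
  continuous_fiber_symm : Continuous fun x => ((fiber x).symm : E →L[𝕜] E)

namespace LinearCocycle

section NormedField

variable {𝕜 X E : Type*} [NontriviallyNormedField 𝕜] [TopologicalSpace X]
  [NormedAddCommGroup E] [NormedSpace 𝕜 E] (φ : LinearCocycle 𝕜 X E)

/-- The inverse cocycle. -/
def symm : LinearCocycle 𝕜 X E where
  base := φ.base.symm
  fiber x := (φ.fiber (φ.base.symm x)).symm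
  continuous_fiber := φ.continuous_fiber_symm.comp φ.base.symm.continuous
  continuous_fiber_symm := φ.continuous_fiber.comp φ.base.symm.continuous

lemma symm_fiber_base (x : X) : φ.symm.fiber (φ.base x) = (φ.fiber x).symm := by
  simp only [symm, Homeomorph.symm_apply_apply]

@[simp] lemma symm_symm : φ.symm.symm = φ :=
  LinearCocycle.ext rfl <| funext fun x => by
    simp only [symm, Homeomorph.symm_symm, Homeomorph.symm_apply_apply,
      ContinuousLinearEquiv.symm_symm]

/-- The action of the `n`-th iterate of a cocycle on the fibre over a point. -/
def iter : ℕ → X → E ≃L[𝕜] E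
  | 0, _ => .refl 𝕜 E
  | n + 1, x => (φ.fiber x).trans (iter n (φ.base x))

@[simp] lemma iter_zero_apply (x : X) (w : E) : φ.iter 0 x w = w := rfl

lemma iter_succ_apply (n : ℕ) (x : X) (w : E) :
    φ.iter (n + 1) x w = φ.iter n (φ.base x) (φ.fiber x w) := rfl

lemma iter_succ_apply' (n : ℕ) (x : X) (w : E) :
    φ.iter (n + 1) x w = φ.fiber (φ.base^[n] x) (φ.iter n x w) := by
  induction n generalizing x w with
  | zero => rfl
  | succ n ih => rw [iter_succ_apply, ih, iter_succ_apply, iterate_succ_apply]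

lemma continuous_iter (n : ℕ) : Continuous fun x => (φ.iter n x : E →L[𝕜] E) := by
  induction n with
  | zero => exact continuous_const (y := ContinuousLinearMap.id 𝕜 E)
  | succ n ih => exact (ih.comp φ.base.continuous).clm_comp φ.continuous_fiber

lemma continuous_iter_apply (n : ℕ) : Continuous fun p : X × E => φ.iter n p.1 p.2 :=
  ((φ.continuous_iter n).comp continuous_fst).clm_apply continuous_snd

/-- The stable space over `x`, encoded as the space of the vectors with bounded forward orbit. The
unstable space is the stable space of the inverse cocycle. -/
def stable (x : X) : Submodule 𝕜 E where
  carrier := {w | ∃ C, ∀ n, ‖φ.iter n x w‖ ≤ C}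
  zero_mem' := ⟨0, fun n => by rw [map_zero, norm_zero]⟩
  add_mem' := by
    rintro v w ⟨C, hC⟩ ⟨D, hD⟩
    refine ⟨C + D, fun n => ?_⟩
    rw [map_add]
    exact norm_add_le_of_le (hC n) (hD n)
  smul_mem' := by
    rintro t w ⟨C, hC⟩
    refine ⟨‖t‖ * C, fun n => ?_⟩
    rw [map_smul, norm_smul]
    exact mul_le_mul_of_nonneg_left (hC n) (norm_nonneg t)

variable {φ} {x : X} {w : E}

lemma fiber_mem_stable_iff : φ.fiber x w ∈ φ.stable (φ.base x) ↔ w ∈ φ.stable x := by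
  constructor
  · rintro ⟨C, hC⟩
    refine ⟨max ‖w‖ C, fun n => ?_⟩
    cases n with
    | zero => exact le_max_left _ _
    | succ n => exact (hC n).trans (le_max_right _ _)
  · exact fun ⟨C, hC⟩ => ⟨C, fun n => hC (n + 1)⟩

lemma fiber_mem_symm_stable_iff :
    φ.fiber x w ∈ φ.symm.stable (φ.base x) ↔ w ∈ φ.symm.stable x := by
  rw [← fiber_mem_stable_iff, symm_fiber_base, ContinuousLinearEquiv.symm_apply_apply]
  simp only [symm, Homeomorph.symm_apply_apply]

lemma iter_mem_stable (hw : w ∈ φ.stable x) (n : ℕ) : φ.iter n x w ∈ φ.stable (φ.base^[n] x) := by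
  induction n with
  | zero => exact hw
  | succ n ih =>
    rw [iter_succ_apply', iterate_succ_apply']
    exact fiber_mem_stable_iff.2 ih

lemma map_eq_of_fiber_mem_iff {S : X → Submodule 𝕜 E}
    (hS : ∀ x w, φ.fiber x w ∈ S (φ.base x) ↔ w ∈ S x) (x : X) :
    (S x).map (φ.fiber x : E →ₗ[𝕜] E) = S (φ.base x) := by
  refine le_antisymm (Submodule.map_le_iff_le_comap.2 fun w => (hS x w).2) fun v hv => ?_
  refine ⟨(φ.fiber x).symm v, (hS x _).1 ?_, (φ.fiber x).apply_symm_apply v⟩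
  rwa [ContinuousLinearEquiv.apply_symm_apply]

/-- The stable vectors over `J` are contracted at a uniform exponential rate. -/
def ContractsStable (φ : LinearCocycle 𝕜 X E) (J : Set X) : Prop :=
  ∃ C r : ℝ, 0 ≤ C ∧ 0 ≤ r ∧ r < 1 ∧
    ∀ x ∈ J, ∀ w ∈ φ.stable x, ∀ n, ‖φ.iter n x w‖ ≤ C * r ^ n * ‖w‖

variable {J : Set X}

/-- Uniformity makes the existential bound in the definition of `stable` a closed condition. -/
lemma ContractsStable.isClosed_stable (h : φ.ContractsStable J) :
    IsClosed {p : J × E | p.2 ∈ φ.stable p.1} := by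
  obtain ⟨C, r, hC, hr₀, hr₁, hle⟩ := h
  have heq : {p : J × E | p.2 ∈ φ.stable p.1} =
      ⋂ n, {p : J × E | ‖φ.iter n p.1 p.2‖ ≤ C * ‖p.2‖} := by
    ext ⟨x, w⟩
    rw [mem_iInter]
    refine ⟨fun hw n => (hle x x.2 w hw n).trans ?_, fun hw => ⟨C * ‖w‖, hw⟩⟩
    exact mul_le_mul_of_nonneg_right
      (mul_le_of_le_one_right hC (pow_le_one₀ hr₀ hr₁.le)) (norm_nonneg w)
  rw [heq]
  refine isClosed_iInter fun n => isClosed_le ?_ (by fun_prop)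
  exact ((φ.continuous_iter_apply n).comp (by fun_prop :
    Continuous fun p : J × E => ((p.1 : X), p.2))).norm

lemma ContractsStable.eventually_pow_mul_norm_iter_le (h : φ.ContractsStable J) :
    ∀ᶠ lam : ℝ≥0 in 𝓝[>] 1, ∀ᶠ N in atTop, ∀ x ∈ J, ∀ w ∈ φ.stable x,
      lam ^ N * ‖φ.iter N x w‖ ≤ ‖w‖ := by
  obtain ⟨C, r, -, hr₀, hr₁, hle⟩ := h
  have hlim : Tendsto (fun lam : ℝ≥0 => (lam : ℝ) * r) (𝓝[>] 1) (𝓝 r) := by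
    have hcont : Continuous fun lam : ℝ≥0 => (lam : ℝ) * r := by fun_prop
    simpa only [NNReal.coe_one, one_mul] using (hcont.tendsto 1).mono_left nhdsWithin_le_nhds
  filter_upwards [hlim.eventually_lt_const hr₁] with lam hlam
  have hzero : Tendsto (fun N => C * (lam * r) ^ N) atTop (𝓝 0) := by
    simpa only [mul_zero] using
      (tendsto_pow_atTop_nhds_zero_of_lt_one (by positivity) hlam).const_mul C
  filter_upwards [hzero.eventually_le_const one_pos] with N hN x hx w hw
  calc lam ^ N * ‖φ.iter N x w‖ ≤ lam ^ N * (C * r ^ N * ‖w‖) := by gcongr; exact hle x hx w hw N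
    _ = C * (lam * r) ^ N * ‖w‖ := by ring
    _ ≤ ‖w‖ := mul_le_of_le_one_left (norm_nonneg w) hN

end NormedField

section Lyapunov

variable {𝕜 X E : Type*} [RCLike 𝕜] [TopologicalSpace X] [NormedAddCommGroup E] [NormedSpace 𝕜 E]

/-- A quadratic Lyapunov function for `φ` over an invariant set: an indefinite function, quadratic
on the fibres, that increases uniformly under `φ`. No continuity in the base point is required, so
that such a function can be assembled from the forms of finitely many boxes. -/
structure IsLyapunov (φ : LinearCocycle 𝕜 X E) (J : Set X) (q : X → E → ℝ) : Prop where
  image_base : φ.base '' J = J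
  continuous : ∀ x ∈ J, Continuous (q x)
  smul : ∀ x ∈ J, ∀ (t : 𝕜) w, q x (t • w) = ‖t‖ ^ 2 * q x w
  exists_pos : ∀ x ∈ J, ∃ w, 0 < q x w
  exists_neg : ∀ x ∈ J, ∃ w, q x w < 0
  bound : ∃ M, ∀ x ∈ J, ∀ w, |q x w| ≤ M * ‖w‖ ^ 2
  increase : ∃ c > 0, ∀ x ∈ J, ∀ w, q x w + c * ‖w‖ ^ 2 ≤ q (φ.base x) (φ.fiber x w)

namespace IsLyapunov

variable {φ : LinearCocycle 𝕜 X E} {J : Set X} {q : X → E → ℝ} {x : X} {w : E}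

lemma iterate_base_mem (h : φ.IsLyapunov J q) (hx : x ∈ J) (n : ℕ) : φ.base^[n] x ∈ J :=
  (mapsTo_iff_image_subset.2 h.image_base.subset).iterate n hx

lemma le_apply_fiber (h : φ.IsLyapunov J q) (hx : x ∈ J) (w : E) :
    q x w ≤ q (φ.base x) (φ.fiber x w) := by
  obtain ⟨c, hc, hinc⟩ := h.increase
  exact (le_add_of_nonneg_right (by positivity)).trans (hinc x hx w)

lemma exists_add_mul_abs_le (h : φ.IsLyapunov J q) :
    ∃ θ > 0, θ ≤ 1 ∧ ∀ x ∈ J, ∀ w, q x w + θ * |q x w| ≤ q (φ.base x) (φ.fiber x w) := by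
  obtain ⟨M, hM⟩ := h.bound
  obtain ⟨c, hc, hinc⟩ := h.increase
  have hpos : 0 < |M| + c := by positivity
  refine ⟨c / (|M| + c), by positivity,
    (div_le_one hpos).2 (le_add_of_nonneg_left (abs_nonneg M)), fun x hx w => ?_⟩
  have hle : |q x w| ≤ (|M| + c) * ‖w‖ ^ 2 := (hM x hx w).trans <| by
    gcongr
    exact (le_abs_self M).trans (le_add_of_nonneg_right hc.le)
  have hratio : c / (|M| + c) * |q x w| ≤ c * ‖w‖ ^ 2 := by
    rw [div_mul_eq_mul_div, div_le_iff₀ hpos]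
    linarith [mul_le_mul_of_nonneg_left hle hc.le]
  linarith [hinc x hx w]

lemma nonpos_of_mem_stable (h : φ.IsLyapunov J q) (hx : x ∈ J) (hw : w ∈ φ.stable x) :
    q x w ≤ 0 := by
  by_contra! hpos
  obtain ⟨θ, hθ, -, hinc⟩ := h.exists_add_mul_abs_le
  obtain ⟨M, hM⟩ := h.bound
  obtain ⟨C, hC⟩ := hw
  have hgrow (n : ℕ) : (1 + θ) ^ n * q x w ≤ q (φ.base^[n] x) (φ.iter n x w) := by
    induction n with
    | zero => simp
    | succ n ih =>
      rw [iter_succ_apply', iterate_succ_apply', pow_succ', mul_assoc]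
      refine le_trans ?_ (hinc _ (h.iterate_base_mem hx n) _)
      linarith [mul_le_mul_of_nonneg_left (ih.trans (le_abs_self _)) hθ.le]
  obtain ⟨n, hn⟩ := pow_unbounded_of_one_lt (|M| * C ^ 2 / q x w) (lt_add_of_pos_right 1 hθ)
  refine ((div_lt_iff₀ hpos).1 hn).not_ge ?_
  calc (1 + θ) ^ n * q x w ≤ |q (φ.base^[n] x) (φ.iter n x w)| := (hgrow n).trans (le_abs_self _)
    _ ≤ M * ‖φ.iter n x w‖ ^ 2 := hM _ (h.iterate_base_mem hx n) _
    _ ≤ |M| * C ^ 2 := by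
      gcongr
      exacts [le_abs_self M, hC n]

lemma exists_norm_iter_le (h : φ.IsLyapunov J q) :
    ∃ C r : ℝ, 0 ≤ C ∧ 0 ≤ r ∧ r < 1 ∧ ∀ x ∈ J, ∀ w,
      (∀ n, q (φ.base^[n] x) (φ.iter n x w) ≤ 0) → ∀ n, ‖φ.iter n x w‖ ≤ C * r ^ n * ‖w‖ := by
  obtain ⟨θ, hθ₀, hθ₁, hθ⟩ := h.exists_add_mul_abs_le
  obtain ⟨M, hM⟩ := h.bound
  obtain ⟨c, hc, hinc⟩ := h.increase
  have hr : 0 ≤ 1 - θ := sub_nonneg.2 hθ₁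
  refine ⟨√(|M| / c), √(1 - θ), Real.sqrt_nonneg _, Real.sqrt_nonneg _,
    (Real.sqrt_lt' one_pos).2 (by linarith), fun x hx w hw n => ?_⟩
  have hdecay (n : ℕ) : -q (φ.base^[n] x) (φ.iter n x w) ≤ (1 - θ) ^ n * (|M| * ‖w‖ ^ 2) := by
    induction n with
    | zero =>
      calc -q x w ≤ M * ‖w‖ ^ 2 := (neg_le_abs _).trans (hM x hx w)
        _ ≤ (1 - θ) ^ 0 * (|M| * ‖w‖ ^ 2) := by
          rw [pow_zero, one_mul]
          gcongr
          exact le_abs_self M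
    | succ n ih =>
      have hstep := hθ _ (h.iterate_base_mem hx n) (φ.iter n x w)
      rw [abs_of_nonpos (hw n), ← iter_succ_apply', ← iterate_succ_apply' φ.base] at hstep
      rw [pow_succ', mul_assoc]
      linarith [mul_le_mul_of_nonneg_left ih hr]
  refine le_of_sq_le_sq ?_ (by positivity)
  rw [mul_pow, mul_pow, ← pow_mul, mul_comm n, pow_mul, Real.sq_sqrt hr,
    Real.sq_sqrt (by positivity), div_mul_eq_mul_div, div_mul_eq_mul_div, le_div_iff₀' hc]
  have hstep := hinc _ (h.iterate_base_mem hx n) (φ.iter n x w)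
  have hnext := hw (n + 1)
  rw [iter_succ_apply', iterate_succ_apply'] at hnext
  linarith [hdecay n]

lemma mem_stable_of_nonpos (h : φ.IsLyapunov J q) (hx : x ∈ J)
    (hw : ∀ n, q (φ.base^[n] x) (φ.iter n x w) ≤ 0) : w ∈ φ.stable x := by
  obtain ⟨C, r, hC, hr₀, hr₁, hle⟩ := h.exists_norm_iter_le
  refine ⟨C * ‖w‖, fun n => (hle x hx w hw n).trans ?_⟩
  exact mul_le_mul_of_nonneg_right
    (mul_le_of_le_one_right hC (pow_le_one₀ hr₀ hr₁.le)) (norm_nonneg w)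

lemma contractsStable (h : φ.IsLyapunov J q) : φ.ContractsStable J := by
  obtain ⟨C, r, hC, hr₀, hr₁, hle⟩ := h.exists_norm_iter_le
  exact ⟨C, r, hC, hr₀, hr₁, fun x hx w hw => hle x hx w fun n =>
    h.nonpos_of_mem_stable (h.iterate_base_mem hx n) (iter_mem_stable hw n)⟩

lemma neg_of_mem_stable (h : φ.IsLyapunov J q) (hx : x ∈ J) (hw : w ∈ φ.stable x)
    (hw₀ : w ≠ 0) : q x w < 0 := by
  obtain ⟨c, hc, hinc⟩ := h.increase
  have hnext : q (φ.base x) (φ.fiber x w) ≤ 0 :=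
    h.nonpos_of_mem_stable (h.iterate_base_mem hx 1) (fiber_mem_stable_iff.2 hw)
  have : 0 < c * ‖w‖ ^ 2 := by positivity
  linarith [hinc x hx w]

/-- The unit vectors with `q ≤ 0` at time `n` form a decreasing sequence of nonempty compact sets,
whose intersection consists of stable vectors. -/
lemma exists_ne_zero_mem_stable [FiniteDimensional 𝕜 E] (h : φ.IsLyapunov J q) (hx : x ∈ J) :
    ∃ w ∈ φ.stable x, w ≠ 0 := by
  have : ProperSpace E := FiniteDimensional.proper 𝕜 E
  let S (n : ℕ) : Set E :=
    Metric.sphere 0 1 ∩ {w | q (φ.base^[n] x) (φ.iter n x w) ≤ 0}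
  have hclosed (n : ℕ) : IsClosed {w | q (φ.base^[n] x) (φ.iter n x w) ≤ 0} :=
    isClosed_le ((h.continuous _ (h.iterate_base_mem hx n)).comp (φ.iter n x).continuous)
      continuous_const
  have hanti (n : ℕ) : S (n + 1) ⊆ S n := by
    refine inter_subset_inter_right _ fun w (hw : q _ _ ≤ 0) => ?_
    rw [iter_succ_apply', iterate_succ_apply'] at hw
    exact (h.le_apply_fiber (h.iterate_base_mem hx n) _).trans hw
  have hne (n : ℕ) : (S n).Nonempty := by
    have hxn := h.iterate_base_mem hx n
    obtain ⟨v, hv⟩ := h.exists_neg _ hxn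
    have hv₀ : v ≠ 0 := by
      rintro rfl
      exact hv.ne (by simpa using h.smul _ hxn 0 0)
    have hw₀ : (φ.iter n x).symm v ≠ 0 := by simpa using hv₀
    refine ⟨(‖(φ.iter n x).symm v‖⁻¹ : 𝕜) • (φ.iter n x).symm v,
      mem_sphere_zero_iff_norm.2 (norm_smul_inv_norm hw₀), ?_⟩
    rw [mem_ofPred, map_smul, ContinuousLinearEquiv.apply_symm_apply, h.smul _ hxn]
    exact mul_nonpos_of_nonneg_of_nonpos (sq_nonneg _) hv.le
  obtain ⟨w, hw⟩ := IsCompact.nonempty_iInter_of_sequence_nonempty_isCompact_isClosed S hanti hne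
    ((isCompact_sphere 0 1).inter_right (hclosed 0))
    fun n => Metric.isClosed_sphere.inter (hclosed n)
  rw [mem_iInter] at hw
  exact ⟨w, h.mem_stable_of_nonpos hx fun n => (hw n).2, ne_zero_of_mem_unit_sphere ⟨w, (hw 0).1⟩⟩

lemma symm (h : φ.IsLyapunov J q) (hJ : IsCompact J) : φ.symm.IsLyapunov J (-q) where
  image_base := by
    conv_lhs => rw [← h.image_base]
    exact φ.base.toEquiv.symm_image_image J
  continuous x hx := (h.continuous x hx).neg
  smul x hx t w := by rw [Pi.neg_apply, Pi.neg_apply, Pi.neg_apply, h.smul x hx, mul_neg]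
  exists_pos x hx := (h.exists_neg x hx).imp fun _ => neg_pos_of_neg
  exists_neg x hx := (h.exists_pos x hx).imp fun _ => neg_neg_of_pos
  bound := by simpa only [Pi.neg_apply, abs_neg] using h.bound
  increase := by
    obtain ⟨c, hc, hinc⟩ := h.increase
    obtain ⟨a, ha⟩ := hJ.exists_bound_of_continuousOn φ.continuous_fiber.continuousOn
    refine ⟨c / (a ^ 2 + 1), by positivity, fun x hx w => ?_⟩
    obtain ⟨y, hy, rfl⟩ := h.image_base.superset hx
    obtain ⟨v, rfl⟩ := (φ.fiber y).surjective w
    have hbase : φ.symm.base (φ.base y) = y := φ.base.symm_apply_apply y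
    rw [symm_fiber_base, ContinuousLinearEquiv.symm_apply_apply, hbase]
    have hv : ‖φ.fiber y v‖ ^ 2 ≤ (a ^ 2 + 1) * ‖v‖ ^ 2 :=
      calc ‖φ.fiber y v‖ ^ 2 ≤ (a * ‖v‖) ^ 2 := by
            gcongr
            exact (φ.fiber y : E →L[𝕜] E).le_of_opNorm_le (ha y hy) v
        _ ≤ (a ^ 2 + 1) * ‖v‖ ^ 2 := by rw [mul_pow]; gcongr; exact (lt_add_one _).le
    have hcv : c / (a ^ 2 + 1) * ‖φ.fiber y v‖ ^ 2 ≤ c * ‖v‖ ^ 2 := by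
      rw [div_mul_eq_mul_div, div_le_iff₀ (by positivity)]
      linarith [mul_le_mul_of_nonneg_left hv hc.le]
    simp only [Pi.neg_apply]
    linarith [hinc y hy v]

lemma disjoint_stable (h : φ.IsLyapunov J q) (hJ : IsCompact J) (hx : x ∈ J) :
    Disjoint (φ.stable x) (φ.symm.stable x) := by
  rw [Submodule.disjoint_def]
  intro w hs hu
  by_contra hw₀
  have hneg : -q x w < 0 := (h.symm hJ).neg_of_mem_stable hx hu hw₀
  linarith [h.neg_of_mem_stable hx hs hw₀]

lemma isCompl_stable (h : φ.IsLyapunov J q) (hJ : IsCompact J) (hE : Module.finrank 𝕜 E = 2)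
    (hx : x ∈ J) : IsCompl (φ.stable x) (φ.symm.stable x) := by
  have : FiniteDimensional 𝕜 E := Module.finite_of_finrank_eq_succ hE
  have hs : 1 ≤ Module.finrank 𝕜 (φ.stable x) :=
    Submodule.one_le_finrank_iff.2 ((Submodule.ne_bot_iff _).2 (h.exists_ne_zero_mem_stable hx))
  have hu : 1 ≤ Module.finrank 𝕜 (φ.symm.stable x) := Submodule.one_le_finrank_iff.2
    ((Submodule.ne_bot_iff _).2 ((h.symm hJ).exists_ne_zero_mem_stable hx))
  have hdisj := h.disjoint_stable hJ hx
  exact ⟨hdisj, codisjoint_iff.2 (Submodule.eq_top_of_disjoint _ _ (by omega) hdisj)⟩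

end IsLyapunov

end Lyapunov

section AdaptedNorm

variable {𝕜 X E : Type*} [NontriviallyNormedField 𝕜] [TopologicalSpace X] [NormedAddCommGroup E]
  [NormedSpace 𝕜 E] (φ : LinearCocycle 𝕜 X E)

/-- The Lyapunov norm `∑ n < N, lam ^ n * ‖φⁿ w‖`, which turns a contraction of the stable vectors
by the factor `lam ^ N` in `N` steps into a contraction by `lam` in each step. -/
def adaptedNorm (lam : ℝ≥0) (N : ℕ) (x : X) : Seminorm 𝕜 E :=
  ∑ n ∈ Finset.range N, lam ^ n • (normSeminorm 𝕜 E).comp (φ.iter n x : E →ₗ[𝕜] E)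

lemma adaptedNorm_apply (lam : ℝ≥0) (N : ℕ) (x : X) (w : E) :
    φ.adaptedNorm lam N x w = ∑ n ∈ Finset.range N, lam ^ n * ‖φ.iter n x w‖ := by
  rw [adaptedNorm, FunLike.coe_sum, Finset.sum_apply]
  exact Finset.sum_congr rfl fun n _ => rfl

lemma continuous_adaptedNorm (lam : ℝ≥0) (N : ℕ) :
    Continuous fun p : X × E => φ.adaptedNorm lam N p.1 p.2 := by
  simp only [adaptedNorm_apply]
  exact continuous_finsetSum _ fun n _ => (φ.continuous_iter_apply n).norm.const_mul _

lemma norm_le_adaptedNorm (lam : ℝ≥0) {N : ℕ} (hN : 0 < N) (x : X) (w : E) :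
    ‖w‖ ≤ φ.adaptedNorm lam N x w := by
  rw [adaptedNorm_apply]
  simpa using Finset.single_le_sum (f := fun n => (lam : ℝ) ^ n * ‖φ.iter n x w‖)
    (fun n _ => by positivity) (Finset.mem_range.2 hN)

variable {φ}

lemma mul_adaptedNorm_fiber_le {lam : ℝ≥0} {N : ℕ} {x : X} {w : E}
    (hN : lam ^ N * ‖φ.iter N x w‖ ≤ ‖w‖) :
    lam * φ.adaptedNorm lam N (φ.base x) (φ.fiber x w) ≤ φ.adaptedNorm lam N x w := by
  have hshift : lam * φ.adaptedNorm lam N (φ.base x) (φ.fiber x w) =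
      ∑ n ∈ Finset.range N, lam ^ (n + 1) * ‖φ.iter (n + 1) x w‖ := by
    simp only [adaptedNorm_apply, Finset.mul_sum, pow_succ', mul_assoc, iter_succ_apply]
  have hsum := Finset.sum_range_succ (fun n => (lam : ℝ) ^ n * ‖φ.iter n x w‖) N
  rw [Finset.sum_range_succ', pow_zero, one_mul, iter_zero_apply] at hsum
  rw [hshift, adaptedNorm_apply]
  linarith

lemma ContractsStable.eventually_mul_adaptedNorm_le {J : Set X} (h : φ.ContractsStable J)
    (hJ : MapsTo φ.symm.base J J) :
    ∀ᶠ lam : ℝ≥0 in 𝓝[>] 1, ∀ᶠ N in atTop, ∀ x ∈ J, ∀ w ∈ φ.stable x,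
      lam * φ.adaptedNorm lam N x w ≤
        φ.adaptedNorm lam N (φ.symm.base x) (φ.symm.fiber x w) := by
  filter_upwards [h.eventually_pow_mul_norm_iter_le] with lam hlam
  filter_upwards [hlam] with N hN x hx w hw
  obtain ⟨y, rfl⟩ := φ.base.surjective x
  obtain ⟨v, rfl⟩ := (φ.fiber y).surjective w
  have hbase : φ.symm.base (φ.base y) = y := φ.base.symm_apply_apply y
  rw [symm_fiber_base, ContinuousLinearEquiv.symm_apply_apply, hbase]
  exact mul_adaptedNorm_fiber_le (hN y (hbase ▸ hJ hx) v (fiber_mem_stable_iff.1 hw))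

variable (φ) in
/-- The norm adapted to the stable spaces of `φ` and of `φ.symm`, where `P x` is the projection
onto the latter along the former. -/
def splitNorm (P : X → E →L[𝕜] E) (lam : ℝ≥0) (N : ℕ) (x : X) : Seminorm 𝕜 E :=
  (φ.adaptedNorm lam N x).comp (LinearMap.id - (P x : E →ₗ[𝕜] E)) +
    (φ.symm.adaptedNorm lam N x).comp (P x : E →ₗ[𝕜] E)

lemma splitNorm_apply (P : X → E →L[𝕜] E) (lam : ℝ≥0) (N : ℕ) (x : X) (w : E) :
    φ.splitNorm P lam N x w =
      φ.adaptedNorm lam N x (w - P x w) + φ.symm.adaptedNorm lam N x (P x w) := rfl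

lemma eq_zero_of_splitNorm_eq_zero {P : X → E →L[𝕜] E} {lam : ℝ≥0} {N : ℕ} (hN : 0 < N) {x : X}
    {w : E} (hw : φ.splitNorm P lam N x w = 0) : w = 0 := by
  rw [splitNorm_apply] at hw
  have htri : ‖w‖ ≤ ‖w - P x w‖ + ‖P x w‖ := by
    simpa only [sub_add_cancel] using norm_add_le (w - P x w) (P x w)
  refine norm_le_zero_iff.1 ?_
  linarith [φ.norm_le_adaptedNorm lam hN x (w - P x w),
    φ.symm.norm_le_adaptedNorm lam hN x (P x w)]

lemma continuousOn_splitNorm {J : Set X} {P : X → E →L[𝕜] E} (hP : ContinuousOn P J) (lam : ℝ≥0)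
    (N : ℕ) : ContinuousOn (fun p : X × E => φ.splitNorm P lam N p.1 p.2) (J ×ˢ univ) := by
  have hproj : ContinuousOn (fun p : X × E => P p.1 p.2) (J ×ˢ univ) :=
    (hP.comp continuousOn_fst fun p hp => hp.1).clm_apply continuousOn_snd
  simp only [splitNorm_apply]
  exact ((φ.continuous_adaptedNorm lam N).comp_continuousOn
    (continuousOn_fst.prodMk (continuousOn_snd.sub hproj))).add
    ((φ.symm.continuous_adaptedNorm lam N).comp_continuousOn (continuousOn_fst.prodMk hproj))

lemma exists_expanding_norm {J : Set X} (hs : φ.ContractsStable J)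
    (hu : φ.symm.ContractsStable J) (hJ : MapsTo φ.base J J) (hJ' : MapsTo φ.symm.base J J)
    {P : X → E →L[𝕜] E} (hP : ContinuousOn P J)
    (hPu : ∀ x ∈ J, ∀ w ∈ φ.symm.stable x, P x w = w) (hPs : ∀ x ∈ J, ∀ w ∈ φ.stable x, P x w = 0) :
    ∃ (nrm : X → Seminorm 𝕜 E) (lam : ℝ), 1 < lam ∧ (∀ x w, nrm x w = 0 → w = 0) ∧
      ContinuousOn (fun p : X × E => nrm p.1 p.2) (J ×ˢ univ) ∧
      (∀ x ∈ J, ∀ w ∈ φ.symm.stable x, lam * nrm x w ≤ nrm (φ.base x) (φ.fiber x w)) ∧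
      ∀ x ∈ J, ∀ w ∈ φ.stable x, lam * nrm x w ≤ nrm (φ.symm.base x) (φ.symm.fiber x w) := by
  have hu' := hu.eventually_mul_adaptedNorm_le (by rwa [symm_symm])
  rw [symm_symm] at hu'
  obtain ⟨lam, ⟨hlam_s, hlam_u⟩, hlam⟩ :=
    (((hs.eventually_mul_adaptedNorm_le hJ').and hu').and self_mem_nhdsWithin).exists
  obtain ⟨N, ⟨hN_s, hN_u⟩, hN⟩ := ((hlam_s.and hlam_u).and (eventually_gt_atTop 0)).exists
  have hnorm_s (x) (hx : x ∈ J) (w) (hw : w ∈ φ.stable x) :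
      φ.splitNorm P lam N x w = φ.adaptedNorm lam N x w := by
    rw [splitNorm_apply, hPs x hx w hw, sub_zero, map_zero, add_zero]
  have hnorm_u (x) (hx : x ∈ J) (w) (hw : w ∈ φ.symm.stable x) :
      φ.splitNorm P lam N x w = φ.symm.adaptedNorm lam N x w := by
    rw [splitNorm_apply, hPu x hx w hw, sub_self, map_zero, zero_add]
  refine ⟨φ.splitNorm P lam N, lam, hlam, fun x w => eq_zero_of_splitNorm_eq_zero hN,
    continuousOn_splitNorm hP lam N, fun x hx w hw => ?_, fun x hx w hw => ?_⟩
  · rw [hnorm_u x hx w hw, hnorm_u _ (hJ hx) _ (fiber_mem_symm_stable_iff.2 hw)]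
    exact hN_u x hx w hw
  · have hw' : φ.symm.fiber x w ∈ φ.stable (φ.symm.base x) := by
      simpa only [symm_symm] using (fiber_mem_symm_stable_iff (φ := φ.symm)).2
        (by rwa [symm_symm])
    rw [hnorm_s x hx w hw, hnorm_s _ (hJ' hx) _ hw']
    exact hN_s x hx w hw

end AdaptedNorm

end LinearCocycle

section Deriv

variable {𝕜 E F : Type*} [NontriviallyNormedField 𝕜] [NormedAddCommGroup E] [NormedSpace 𝕜 E]
  [NormedAddCommGroup F] [NormedSpace 𝕜 F]

lemma leftInverse_fderiv {f : E → F} {g : F → E} (h : LeftInverse g f) {x : E}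
    (hf : DifferentiableAt 𝕜 f x) (hg : DifferentiableAt 𝕜 g (f x)) :
    LeftInverse (fderiv 𝕜 g (f x)) (fderiv 𝕜 f x) := by
  have hcomp : (fderiv 𝕜 g (f x)).comp (fderiv 𝕜 f x) = .id 𝕜 E := by
    rw [← fderiv_comp x hg hf, h.comp_eq_id, fderiv_id]
  exact fun w => congrArg (fun L : E →L[𝕜] E => L w) hcomp

/-- The derivative cocycle of a `C¹` diffeomorphism `f`, acting on the tangent bundle. -/
noncomputable def derivCocycle (f : E ≃ E) (hf : ContDiff 𝕜 1 f) (hf' : ContDiff 𝕜 1 f.symm) :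
    LinearCocycle 𝕜 E E where
  base := ⟨f, hf.continuous, hf'.continuous⟩
  fiber x := .equivOfInverse (fderiv 𝕜 f x) (fderiv 𝕜 f.symm (f x))
    (leftInverse_fderiv f.symm_apply_apply (hf.differentiable one_ne_zero x)
      (hf'.differentiable one_ne_zero (f x)))
    (fun w => by
      simpa only [f.symm_apply_apply] using leftInverse_fderiv f.apply_symm_apply
        (hf'.differentiable one_ne_zero (f x)) (hf.differentiable one_ne_zero _) w)
  continuous_fiber := hf.continuous_fderiv one_ne_zero
  continuous_fiber_symm := (hf'.continuous_fderiv one_ne_zero).comp hf.continuous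

lemma symm_derivCocycle_fiber_apply {f : E ≃ E} (hf : ContDiff 𝕜 1 f) (hf' : ContDiff 𝕜 1 f.symm)
    (x w : E) : (derivCocycle f hf hf').symm.fiber x w = fderiv 𝕜 f.symm x w := by
  obtain ⟨y, rfl⟩ := f.surjective x
  exact congrArg (fun L : E ≃L[𝕜] E => L w) (LinearCocycle.symm_fiber_base _ y)

end Deriv

lemma isHyperbolicOn_of_isLyapunov {f : C2 ≃ C2} {hf : ContDiff ℂ 1 f}
    {hf' : ContDiff ℂ 1 f.symm} {J : Set C2} {q : C2 → C2 → ℝ} (hJ : IsCompact J)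
    (h : (derivCocycle f hf hf').IsLyapunov J q) : IsHyperbolicOn f J := by
  have hsymm := h.symm hJ
  have hcompl (x : C2) (hx : x ∈ J) : IsCompl ((derivCocycle f hf hf').stable x)
      ((derivCocycle f hf hf').symm.stable x) := h.isCompl_stable hJ (by simp) hx
  obtain ⟨P, hP, hPsu⟩ := exists_continuousOn_projection h.contractsStable.isClosed_stable
    hsymm.contractsStable.isClosed_stable hcompl
  obtain ⟨nrm, lam, hlam, hdef, hcont, hu, hs⟩ :=
    LinearCocycle.exists_expanding_norm h.contractsStable hsymm.contractsStable
      (fun x hx => h.iterate_base_mem hx 1) (fun x hx => hsymm.iterate_base_mem hx 1) hP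
      (fun x hx => (hPsu x hx).1) (fun x hx => (hPsu x hx).2)
  simp only [symm_derivCocycle_fiber_apply] at hs
  exact ⟨hJ, h.image_base, _, _, P, nrm, lam, hcompl, hPsu, hP,
    fun x _ => LinearCocycle.map_eq_of_fiber_mem_iff
      (fun _ _ => LinearCocycle.fiber_mem_stable_iff) x,
    fun x _ => LinearCocycle.map_eq_of_fiber_mem_iff
      (fun _ _ => LinearCocycle.fiber_mem_symm_stable_iff) x,
    fun x _ => hdef x, hcont, hlam, hu, hs⟩

section Boxes

lemma continuous_boxNorm : Continuous boxNorm := by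
  unfold boxNorm
  fun_prop

lemma norm_le_two_mul_boxNorm (x : C2) : ‖x‖ ≤ 2 * boxNorm x := by
  have hcoord (i : Fin 2) : |(x i).re| ≤ boxNorm x ∧ |(x i).im| ≤ boxNorm x := by
    fin_cases i <;> simp [boxNorm]
  refine (pi_norm_le_iff_of_nonneg ?_).2 fun i => ?_
  · linarith [(hcoord 0).1, abs_nonneg (x 0).re]
  · linarith [Complex.norm_le_abs_re_add_abs_im (x i), hcoord i]

lemma isCompact_box (c : C2) (r : ℝ) : IsCompact (box c r) := by
  refine (isCompact_closedBall c (2 * r)).of_isClosed_subset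
    (isClosed_le (continuous_boxNorm.comp (continuous_sub_right c)) continuous_const)
    fun x (hx : boxNorm (x - c) ≤ r) => mem_closedBall_iff_norm.2 ?_
  linarith [norm_le_two_mul_boxNorm (x - c)]

lemma subset_nbhd {δ : ℝ} (hδ : 0 < δ) (B : Set C2) : B ⊆ nbhd B δ := fun x hx =>
  ⟨x, hx, by simpa [boxNorm] using hδ⟩

lemma BoxChainModel.isCompact {f : C2 ≃ C2} {J : Set C2} (Γ : BoxChainModel f J)
    (hJ : IsClosed J) : IsCompact J :=
  (isCompact_iUnion fun k => isCompact_box (Γ.center k) (Γ.radius k)).of_isClosed_subset hJ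
    Γ.covers

end Boxes

section Forms

variable {A A' : Matrix (Fin 2) (Fin 2) ℂ}

lemma continuous_form (A : Matrix (Fin 2) (Fin 2) ℂ) : Continuous (form A) := by
  unfold form
  fun_prop

lemma form_smul (A : Matrix (Fin 2) (Fin 2) ℂ) (t : ℂ) (w : C2) :
    form A (t • w) = ‖t‖ ^ 2 * form A w := by
  have ht : star t * t = ((‖t‖ ^ 2 : ℝ) : ℂ) := by
    rw [Complex.star_def, Complex.conj_mul', Complex.ofReal_pow]
  rw [form, form, star_smul, Matrix.mulVec_smul, smul_dotProduct, dotProduct_smul, smul_smul, ht,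
    smul_eq_mul, Complex.re_ofReal_mul]

/-- If `w` is in the stable cone but `L w` is in the unstable one, then the two forms have different
signs. In the other cases one of the expansion conditions applies. -/
lemma form_lt_form_apply {L : C2 →L[ℂ] C2} (hL : L.IsInvertible)
    (hu : ∀ w ∈ unstableCone A, w ≠ 0 → form A w < form A' (L w))
    (hs : ∀ v ∈ stableCone A', -form A' v < -form A (L.inverse v)) {w : C2} (hw : w ≠ 0) :
    form A w < form A' (L w) := by
  by_cases hwA : w ∈ unstableCone A
  · exact hu w hwA hw
  by_cases hwA' : L w ∈ unstableCone A'
  · exact (not_le.1 hwA).trans_le hwA'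
  · have hexp := hs (L w) hwA'
    rw [hL.inverse_apply_self] at hexp
    exact neg_lt_neg_iff.1 hexp

lemma eventually_form_add_le {f : C2 → C2} (hf : ContDiff ℂ 1 f) {B : Set C2} (hB : IsCompact B)
    (h : ∀ z ∈ B, ∀ w ≠ 0, form A w < form A' (fderiv ℂ f z w)) :
    ∀ᶠ c in 𝓝[>] (0 : ℝ), ∀ z ∈ B, ∀ w,
      form A w + c * ‖w‖ ^ 2 ≤ form A' (fderiv ℂ f z w) := by
  have hcont : Continuous fun p : C2 × C2 => form A' (fderiv ℂ f p.1 p.2) - form A p.2 :=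
    ((continuous_form A').comp (hf.continuous_fderiv_apply one_ne_zero)).sub
      ((continuous_form A).comp continuous_snd)
  have hinc := eventually_mul_norm_sq_le (𝕜 := ℂ) hB
    (g := fun z w => form A' (fderiv ℂ f z w) - form A w) hcont
    (fun z t w => by rw [map_smul, form_smul, form_smul, mul_sub])
    fun z hz w hw => sub_pos.2 (h z hz w hw)
  filter_upwards [hinc] with c hc z hz w
  linarith [hc z hz w]

lemma isLyapunov_of_form {f : C2 ≃ C2} {hf : ContDiff ℂ 1 f} {hf' : ContDiff ℂ 1 f.symm}
    {J : Set C2} (hfJ : f '' J = J) {ι : Type*} [Finite ι] {Q : ι → Matrix (Fin 2) (Fin 2) ℂ}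
    (hQ : ∀ i, IsIndefiniteHermitian (Q i)) {A : C2 → Matrix (Fin 2) (Fin 2) ℂ}
    (hA : ∀ x ∈ J, A x ∈ range Q)
    (hinc : ∃ c > 0, ∀ x ∈ J, ∀ w,
      form (A x) w + c * ‖w‖ ^ 2 ≤ form (A (f x)) (fderiv ℂ f x w)) :
    (derivCocycle f hf hf').IsLyapunov J fun x => form (A x) := by
  have hindef (x : C2) (hx : x ∈ J) : IsIndefiniteHermitian (A x) := by
    obtain ⟨i, hi⟩ := hA x hx
    exact hi ▸ hQ i
  have hbound : ∀ᶠ M in atTop, ∀ i w, |form (Q i) w| ≤ M * ‖w‖ ^ 2 :=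
    eventually_all.2 fun i =>
      eventually_abs_le_mul_norm_sq (𝕜 := ℂ) (continuous_form (Q i)) (form_smul (Q i))
  obtain ⟨M, hM⟩ := hbound.exists
  refine ⟨hfJ, fun x _ => continuous_form (A x), fun x _ => form_smul (A x),
    fun x hx => (hindef x hx).2.2.1, fun x hx => (hindef x hx).2.2.2, ⟨M, fun x hx w => ?_⟩, hinc⟩
  obtain ⟨i, hi⟩ := hA x hx
  exact hi ▸ hM i w

lemma BoxChainModel.IsBoxHyperbolic.exists_isLyapunov {f : C2 ≃ C2} (hf : ContDiff ℂ 1 f)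
    (hf' : ContDiff ℂ 1 f.symm) {J : Set C2} (hfJ : f '' J = J) {Γ : BoxChainModel f J}
    (hΓ : Γ.IsBoxHyperbolic) : ∃ q, (derivCocycle f hf hf').IsLyapunov J q := by
  obtain ⟨Q, hQ, hcone⟩ := hΓ
  obtain ⟨δ, hδ, hedge⟩ := Γ.has_edges
  have hinc : ∀ᶠ c in 𝓝[>] (0 : ℝ), ∀ k j, Γ.graph.Adj k j → ∀ z ∈ Γ.B k, ∀ w,
      form (Q k) w + c * ‖w‖ ^ 2 ≤ form (Q j) (fderiv ℂ f z w) := by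
    simp only [eventually_all]
    refine fun k j hkj => eventually_form_add_le hf (isCompact_box _ _) fun z hz w hw => ?_
    exact form_lt_form_apply ⟨(derivCocycle f hf hf').fiber z, rfl⟩
      (fun w hw hw₀ => ((hcone k j hkj z hz).1 w hw hw₀).2)
      (fun v hv => ((hcone k j hkj z hz).2 v hv).2) hw
  obtain ⟨c, hc, hc₀⟩ := (hinc.and self_mem_nhdsWithin).exists
  have hcover : ∀ x ∈ J, ∃ A, ∃ k, x ∈ Γ.B k ∧ Q k = A := fun x hx =>
    (mem_iUnion.1 (Γ.covers hx)).elim fun k hk => ⟨Q k, k, hk, rfl⟩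
  choose! A hA using hcover
  refine ⟨_, isLyapunov_of_form hfJ hQ (fun x hx => (hA x hx).imp fun _ => And.right)
    ⟨c, hc₀, fun x hx w => ?_⟩⟩
  obtain ⟨k, hxk, hAk⟩ := hA x hx
  obtain ⟨j, hfxj, hAj⟩ := hA (f x) (hfJ.subset (mem_image_of_mem f hx))
  rw [← hAk, ← hAj]
  exact hc k j (hedge k j ⟨f x, mem_image_of_mem f hxk, subset_nbhd hδ _ hfxj⟩) x hxk w

end Forms

section PolynomialDiffeo

lemma contDiff_symm_of_differentiable_real {E : Type*} [NormedAddCommGroup E] [NormedSpace ℂ E]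
    [FiniteDimensional ℂ E] {f : E ≃ E} {n : WithTop ℕ∞} (hn : n ≠ 0) (hf : ContDiff ℂ n f)
    (hf' : Differentiable ℝ f.symm) : ContDiff ℂ n f.symm := by
  have : CompleteSpace E := FiniteDimensional.complete ℂ E
  have hdiff : Differentiable ℂ f := hf.differentiable hn
  have hinj (x : E) : Injective (fderiv ℂ f x) := by
    have hleft := leftInverse_fderiv f.symm_apply_apply ((hdiff x).restrictScalars ℝ) (hf' (f x))
    rw [(hdiff x).fderiv_restrictScalars ℝ] at hleft
    exact hleft.injective
  let D (x : E) : E ≃L[ℂ] E :=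
    (LinearEquiv.ofInjectiveEndo (fderiv ℂ f x : E →ₗ[ℂ] E) (hinj x)).toContinuousLinearEquiv
  let F : E ≃ₜ E := ⟨f, hf.continuous, hf'.continuous⟩
  exact F.contDiff_symm (f₀' := D) (fun x => (hdiff x).hasFDerivAt) hf

lemma Represents.contDiff {p : Fin 2 → MvPolynomial (Fin 2) ℂ} {F : C2 → C2}
    (hp : Represents p F) {n : WithTop ℕ∞} : ContDiff ℂ n F := by
  refine contDiff_pi.2 fun i => ?_
  rw [funext fun x => hp x i]
  exact (AnalyticOnNhd.eval_mvPolynomial (p i)).contDiff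

variable {f : C2 ≃ C2}

lemma IsPolynomialDiffeo.contDiff (hf : IsPolynomialDiffeo f) {n : WithTop ℕ∞} :
    ContDiff ℂ n f :=
  hf.1.choose_spec.contDiff

lemma IsPolynomialDiffeo.contDiff_symm (hf : IsPolynomialDiffeo f) {n : WithTop ℕ∞} (hn : n ≠ 0) :
    ContDiff ℂ n f.symm :=
  contDiff_symm_of_differentiable_real hn hf.contDiff (hf.2.differentiable (by simp))

end PolynomialDiffeo

section JuliaSet

lemma preimage_Kplus (f : C2 ≃ C2) : f ⁻¹' Kplus f = Kplus f := by
  ext x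
  have horbit : (range fun n : ℕ => f^[n] x) = insert x (range fun n : ℕ => f^[n] (f x)) := by
    ext y
    constructor
    · rintro ⟨n, rfl⟩
      cases n with
      | zero => exact .inl rfl
      | succ n => exact .inr ⟨n, rfl⟩
    · rintro (rfl | ⟨n, rfl⟩)
      exacts [⟨0, rfl⟩, ⟨n + 1, rfl⟩]
  change Bornology.IsBounded (range fun n : ℕ => f^[n] (f x)) ↔
    Bornology.IsBounded (range fun n : ℕ => f^[n] x)
  rw [horbit, Bornology.isBounded_insert]

lemma isClosed_juliaSet (f : C2 ≃ C2) : IsClosed (juliaSet f) :=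
  isClosed_frontier.inter isClosed_frontier

lemma image_juliaSet {f : C2 ≃ C2} (hf : Continuous f) (hf' : Continuous f.symm) :
    f '' juliaSet f = juliaSet f := by
  let F : C2 ≃ₜ C2 := ⟨f, hf, hf'⟩
  have hfrontier {s : Set C2} (hs : f '' s = s) : f '' frontier s = frontier s := by
    conv_rhs => rw [← hs]
    exact F.image_frontier s
  have hplus : f '' Kplus f = Kplus f := by
    conv_lhs => rw [← preimage_Kplus, f.image_preimage]
  have hminus : f '' Kminus f = Kminus f := by
    rw [f.image_eq_preimage_symm]
    exact preimage_Kplus f.symm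
  rw [juliaSet, image_inter f.injective, hfrontier hplus, hfrontier hminus]

end JuliaSet

end BoxHyp

theorem theorem1p2_general (f : BoxHyp.C2 ≃ BoxHyp.C2) (hf : ContDiff ℂ 1 f)
    (hf' : ContDiff ℂ 1 f.symm) {J : Set BoxHyp.C2} (hJ : IsClosed J) (hfJ : f '' J = J)
    (Γ : BoxHyp.BoxChainModel f J) (hΓ : Γ.IsBoxHyperbolic) : BoxHyp.IsHyperbolicOn f J := by
  obtain ⟨q, hq⟩ := hΓ.exists_isLyapunov hf hf' hfJ
  exact BoxHyp.isHyperbolicOn_of_isLyapunov (Γ.isCompact hJ) hq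

theorem theorem1p2 (f : BoxHyp.C2 ≃ BoxHyp.C2) (hf : BoxHyp.IsPolynomialDiffeo f)
    (d : ℝ) (hd : BoxHyp.HasDynamicalDegree f d) (hd1 : 1 < d)
    (Γ : BoxHyp.BoxChainModel f (BoxHyp.juliaSet f)) (hΓ : Γ.IsBoxHyperbolic) :
    BoxHyp.IsHyperbolicOn f (BoxHyp.juliaSet f) :=
  have hf₁ : ContDiff ℂ 1 f := hf.contDiff
  have hf₁' : ContDiff ℂ 1 f.symm := hf.contDiff_symm one_ne_zero
  theorem1p2_general f hf₁ hf₁' (BoxHyp.isClosed_juliaSet f)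
    (BoxHyp.image_juliaSet hf₁.continuous hf₁'.continuous) Γ hΓ
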